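/- Let $\mathcal{X}^B=(\mathcal{X}^B_t)_{t\ge 0}$ be an irreducible, time-homogeneous, continuous-time Markov chain (with right-continuous paths) on the finite state space $\{1,2,\dots,s\}$, $s\ge 2$, with transition rate matrix $Q^B$; thus $Q^B_{ij}\ge 0$ is the rate from $i$ to $j$ for $i\ne j$, and $Q^B_{ii}=-\sum_{j\ne i}Q^B_{ij}$. For $\varepsilon\in\{1,2\}$ let $\sigma^B_\varepsilon$ be the first hitting time of $\varepsilon$ after leaving the initial state: $\sigma^B_\varepsilon=\inf\{t>0 : \mathcal{X}^B_t=\varepsilon\}$ if $\mathcal{X}^B_0\ne\varepsilon$, and $\sigma^B_\varepsilon=\inf\{t>0 : \mathcal{X}^B_t=\varepsilon \text{ and } \mathcal{X}^B_u\ne\varepsilon \text{ for some } u\in(0,t)\}$ if $\mathcal{X}^B_0=\varepsilon$ (with $\inf\emptyset=\infty$). For $i\in\{1,\dots,s\}$ and $\varepsilon'\in\{1,2\}$ put $$p^B_{iB\varepsilon'}:=\mathrm{P}\big(\sigma^B_{\varepsilon'}<\sigma^B_{3-\varepsilon'}\,\big|\,\mathcal{X}^B_0=i\big).$$ Let $Q^B_0$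 be the matrix obtained from $Q^B$ by replacing the off-diagonal entries of columns $1$ and $2$ by zero. Then $(p^B_{1B1},p^B_{2B1},p^B_{3B1},\dots,p^B_{sB1})^{\mathrm T}$ is the unique solution $u\in\mathbb{R}^s$ of $$Q^B_0\,u=(0,-Q^B_{21},-Q^B_{31},\dots,-Q^B_{s1})^{\mathrm T},$$ and $(p^B_{1B2},p^B_{2B2},p^B_{3B2},\dots,p^B_{sB2})^{\mathrm T}$ is the unique solution $u\in\mathbb{R}^s$ of $$Q^B_0\,u=(-Q^B_{12},0,-Q^B_{32},\dots,-Q^B_{s2})^{\mathrm T}.$$ Moreover $p^B_{iB1}+p^B_{iB2}=1$ for every $i\in\{1,\dots,s\}$, so that it suffices to solve one of the two systems. -/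

import Mathlib

open MeasureTheory Filter Topology
open scoped NNReal ENNReal Matrix

noncomputable section

/-- `Q` is a transition rate matrix: nonnegative off-diagonal rates, and
`Q i i = - ∑ j ≠ i, Q i j`. -/
structure IsRateMatrix {V : Type*} [Fintype V] [DecidableEq V] (Q : Matrix V V ℝ) : Prop where
  rate_nonneg : ∀ i j, i ≠ j → 0 ≤ Q i j
  diag_eq : ∀ i, Q i i = -∑ j ∈ Finset.univ.erase i, Q i j

/-- Irreducibility: every state leads to every other one through transitions of positive rate. -/
def IsIrreducibleRate {V : Type*} (Q : Matrix V V ℝ) : Prop :=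
  ∀ i j, Relation.ReflTransGen (fun a b => a ≠ b ∧ 0 < Q a b) i j

/-- `X` is, under the family of laws `P i` (the process started from `i`), a time-homogeneous
continuous-time Markov chain with transition rate matrix `Q`: its paths are almost surely
right-continuous (for the discrete topology on the state space `V`) and its transition
probabilities over a time span `τ` are the entries of `exp (τ Q)`. -/
structure IsMarkovJumpProcess {V Ω : Type*} [Fintype V] [DecidableEq V] [MeasurableSpace Ω]
    (Q : Matrix V V ℝ) (P : V → Measure Ω) (X : ℝ≥0 → Ω → V) : Prop where
  isProbabilityMeasure : ∀ i, IsProbabilityMeasure (P i)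
  measurableSet_eq : ∀ t v, MeasurableSet {ω | X t ω = v}
  right_continuous : ∀ i, ∀ᵐ ω ∂(P i), ∀ t, ∀ᶠ u in 𝓝[>] t, X u ω = X t ω
  start : ∀ i, ∀ᵐ ω ∂(P i), X 0 ω = i
  markov : ∀ (i : V) (n : ℕ) (t : ℕ → ℝ≥0) (x : ℕ → V), Monotone t →
    (P i).real {ω | ∀ k ≤ n + 1, X (t k) ω = x k} =
      (P i).real {ω | ∀ k ≤ n, X (t k) ω = x k} *
        NormedSpace.exp (((t (n + 1) : ℝ) - (t n : ℝ)) • Q) (x n) (x (n + 1))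

/-- The times at which the path `t ↦ X t ω` may be said to hit `e` after leaving its initial
state: if the path starts from `e`, it has to have been elsewhere before. -/
def hitTimes {V Ω : Type*} (X : ℝ≥0 → Ω → V) (e : V) (ω : Ω) : Set ℝ≥0 :=
  {t | 0 < t ∧ X t ω = e ∧ (X 0 ω = e → ∃ u, 0 < u ∧ u < t ∧ X u ω ≠ e)}

/-- The first hitting (or return) time `σ_e` of `e`, equal to `∞` if `e` is never hit. -/
def hitTime {V Ω : Type*} (X : ℝ≥0 → Ω → V) (e : V) (ω : Ω) : ℝ≥0∞ :=
  sInf ((fun t : ℝ≥0 => (t : ℝ≥0∞)) '' hitTimes X e ω)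

/-- The probability, for the process started from `i`, that `e` is hit (or returned to)
strictly before `e'`, that is, `P_i (σ_e < σ_{e'})`. -/
def excursionProb {V Ω : Type*} [MeasurableSpace Ω] (P : V → Measure Ω) (X : ℝ≥0 → Ω → V)
    (e e' : V) (i : V) : ℝ :=
  (P i).real {ω | hitTime X e ω < hitTime X e' ω}

/-- `Q` with the off-diagonal entries of the columns `e` and `e'` replaced by zero. -/
def zeroedRate {V : Type*} [DecidableEq V] (Q : Matrix V V ℝ) (e e' : V) : Matrix V V ℝ :=
  Matrix.of fun i j => if i ≠ j ∧ (j = e ∨ j = e') then 0 else Q i j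

/-- The vector with entry `0` at `e` and `- Q i e` at `i ≠ e`. -/
def excursionRhs {V : Type*} [DecidableEq V] (Q : Matrix V V ℝ) (e : V) : V → ℝ :=
  fun i => if i = e then 0 else -Q i e

end

/-! ### The linear system -/

section LinearSystem

/-! The linear system is first-step analysis, done in discrete time and passed to the limit, which
avoids jump chains and the strong Markov property. Sampled at multiples of `δ`, the path is a Markov
chain with transition matrix `exp (δ Q)`. Conditioning on its first step gives an exact linear
system for its excursion probabilities, with `(exp (δ Q) - 1) / δ` in place of `Q`
(`zeroedRate_mulVec_skeleton`). As `δ → 0` this matrix tends to `Q`, and right-continuity makes the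
sampled excursion event almost surely agree eventually with the true one, so the probabilities
converge too.

Uniqueness is a maximum principle combined with irreducibility. It also gives the sum `1` without
any recurrence argument: the rows of `Q` sum to zero, so the constant vector `1` solves the sum of
the two systems. -/

theorem zeroedRate_comm {V : Type*} [DecidableEq V] (Q : Matrix V V ℝ) (a b : V) :
    zeroedRate Q a b = zeroedRate Q b a := by
  ext i j
  simp only [zeroedRate, Matrix.of_apply, or_comm]

variable {V : Type*} [Fintype V] [DecidableEq V]

theorem zeroedRate_mulVec_apply (Q : Matrix V V ℝ) (a b : V) (u : V → ℝ) (i : V) :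
    (zeroedRate Q a b *ᵥ u) i =
      Q i i * u i + ∑ j ∈ Finset.univ.erase i, if j = a ∨ j = b then 0 else Q i j * u j := by
  rw [Matrix.mulVec, dotProduct, ← Finset.add_sum_erase _ _ (Finset.mem_univ i)]
  congr 1
  · simp [zeroedRate]
  · refine Finset.sum_congr rfl fun j hj => ?_
    have hij : i ≠ j := (Finset.ne_of_mem_erase hj).symm
    by_cases h : j = a ∨ j = b <;> simp [zeroedRate, h, hij]

theorem zeroedRate_mulVec_one {Q : Matrix V V ℝ} (hQ : IsRateMatrix Q) {a b : V} (hab : a ≠ b) :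
    zeroedRate Q a b *ᵥ 1 = excursionRhs Q a + excursionRhs Q b := by
  ext i
  rw [zeroedRate_mulVec_apply, hQ.diag_eq]
  have h : ∀ j ∈ Finset.univ.erase i, (if j = a ∨ j = b then 0 else Q i j * (1 : V → ℝ) j) =
      Q i j - (if j = a then Q i j else 0) - if j = b then Q i j else 0 := by
    intro j _
    by_cases ha : j = a
    · subst ha; simp [hab]
    · by_cases hb : j = b
      · subst hb; simp [hab.symm]
      · simp [ha, hb]
  rw [Finset.sum_congr rfl h, Finset.sum_sub_distrib, Finset.sum_sub_distrib,
    Finset.sum_ite_eq', Finset.sum_ite_eq']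
  rw [Pi.one_apply, mul_one, Pi.add_apply]
  by_cases ha : i = a
  · subst ha; simp [excursionRhs, hab, hab.symm]; ring
  · by_cases hb : i = b
    · subst hb; simp [excursionRhs, hab, hab.symm]; ring
    · simp [excursionRhs, ha, hb, Ne.symm ha, Ne.symm hb]; ring

/-- Maximum principle: the modulus of a null vector, if maximal at `i`, is maximal at every state
that can be reached from `i` in one transition, and none of these is `a` or `b`. -/
theorem abs_eq_of_zeroedRate_mulVec_eq_zero {Q : Matrix V V ℝ} (hQ : IsRateMatrix Q) {a b : V}
    {v : V → ℝ} (hv : zeroedRate Q a b *ᵥ v = 0) {i : V} (hi : ∀ j, |v j| ≤ |v i|)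
    (hpos : 0 < |v i|) {j : V} (hij : i ≠ j) (hrate : 0 < Q i j) :
    (j ≠ a ∧ j ≠ b) ∧ |v j| = |v i| := by
  have h0 := congrFun hv i
  rw [zeroedRate_mulVec_apply, hQ.diag_eq, Pi.zero_apply] at h0
  -- Bounded by the maximum `|v i|`, while its average with the rates out of `i` attains that
  -- maximum; hence equality wherever the rate is positive.
  set w : V → ℝ := fun j => if j = a ∨ j = b then 0 else |v j| with hw
  have hwle : ∀ j, w j ≤ |v i| := by
    intro j
    simp only [hw]
    split_ifs
    · exact abs_nonneg _
    · exact hi j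
  have hle : (∑ j ∈ Finset.univ.erase i, Q i j) * |v i| ≤
      ∑ j ∈ Finset.univ.erase i, Q i j * w j := by
    calc (∑ j ∈ Finset.univ.erase i, Q i j) * |v i|
        = |(∑ j ∈ Finset.univ.erase i, Q i j) * v i| := by
          rw [abs_mul, abs_of_nonneg (Finset.sum_nonneg fun j hj =>
            hQ.rate_nonneg i j (Finset.ne_of_mem_erase hj).symm)]
      _ = |∑ j ∈ Finset.univ.erase i, if j = a ∨ j = b then 0 else Q i j * v j| := by
          congr 1; linarith
      _ ≤ ∑ j ∈ Finset.univ.erase i, |if j = a ∨ j = b then 0 else Q i j * v j| :=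
          Finset.abs_sum_le_sum_abs _ _
      _ = ∑ j ∈ Finset.univ.erase i, Q i j * w j := by
          refine Finset.sum_congr rfl fun j hj => ?_
          have := hQ.rate_nonneg i j (Finset.ne_of_mem_erase hj).symm
          simp only [hw]
          split_ifs
          · simp
          · rw [abs_mul, abs_of_nonneg this]
  rw [Finset.sum_mul] at hle
  have hterm : ∀ j ∈ Finset.univ.erase i, Q i j * w j ≤ Q i j * |v i| := fun j hj =>
    mul_le_mul_of_nonneg_left (hwle j) (hQ.rate_nonneg i j (Finset.ne_of_mem_erase hj).symm)
  have heq := (Finset.sum_eq_sum_iff_of_le hterm).1 (le_antisymm (Finset.sum_le_sum hterm) hle) j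
    (Finset.mem_erase.2 ⟨hij.symm, Finset.mem_univ j⟩)
  have hwj : w j = |v i| := mul_left_cancel₀ hrate.ne' heq
  by_cases hj : j = a ∨ j = b
  · simp only [hw, hj, if_true] at hwj
    exact absurd hwj hpos.ne
  · simp only [hw, hj, if_false] at hwj
    exact ⟨not_or.1 hj, hwj⟩

/-- A nonzero maximum of `|v|` spreads from a maximiser along positive rates and may never step into
`a` or `b`. Irreducibility reaches both, and at most one of them is the starting maximiser. -/
theorem eq_zero_of_zeroedRate_mulVec_eq_zero {Q : Matrix V V ℝ} (hQ : IsRateMatrix Q)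
    (hirr : IsIrreducibleRate Q) {a b : V} (hab : a ≠ b) {v : V → ℝ}
    (hv : zeroedRate Q a b *ᵥ v = 0) : v = 0 := by
  have : Nonempty V := ⟨a⟩
  obtain ⟨i, hi⟩ := Finite.exists_max fun j => |v j|
  by_contra hne
  have hpos : 0 < |v i| := by
    obtain ⟨j, hj⟩ := Function.ne_iff.1 hne
    exact (abs_pos.2 hj).trans_le (hi j)
  have hreach : ∀ j, |v j| = |v i| ∧ (j = i ∨ j ≠ a ∧ j ≠ b) := by
    intro j
    induction hirr i j with
    | refl => exact ⟨rfl, Or.inl rfl⟩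
    | tail _ hstep ih =>
      obtain ⟨hj, hmax⟩ := abs_eq_of_zeroedRate_mulVec_eq_zero hQ hv
        (fun k => (hi k).trans ih.1.ge) (ih.1 ▸ hpos) hstep.1 hstep.2
      exact ⟨hmax.trans ih.1, Or.inr hj⟩
  rcases (hreach a).2 with h | h
  · rcases (hreach b).2 with h' | h'
    · exact hab (h.trans h'.symm)
    · exact h'.2 rfl
  · exact h.1 rfl

end LinearSystem

/-! ### Hitting times of sequences -/

section Sequences

variable {V : Type*}

/-- The sequence `p` is at `e` at the time `n > 0`, after having been elsewhere. -/
def SeqHits (p : ℕ → V) (e : V) (n : ℕ) : Prop :=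
  0 < n ∧ p n = e ∧ (p 0 = e → ∃ m < n, p m ≠ e)

/-- The sequences that hit `e` strictly before `e'`. -/
def seqExcursion (e e' : V) : Set (ℕ → V) :=
  {p | ∃ n, SeqHits p e n ∧ ∀ m ≤ n, ¬ SeqHits p e' m}

/-- Time `0` can be forgotten unless the first step is itself a hit: staying put keeps the
requirement to leave, and a step to a state other than `e` fulfils it. -/
theorem seqHits_succ_iff {p : ℕ → V} {e : V} (h : p 1 = p 0 ∨ p 1 ≠ e) (n : ℕ) :
    SeqHits p e (n + 1) ↔ SeqHits (fun k => p (k + 1)) e n := by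
  rcases n.eq_zero_or_pos with rfl | hn
  · simp only [SeqHits, lt_irrefl, false_and, iff_false, zero_add]
    rintro ⟨-, h1, h2⟩
    rcases h with h | h
    · obtain ⟨m, hm, hme⟩ := h2 (h ▸ h1)
      obtain rfl : m = 0 := by omega
      exact hme (h ▸ h1)
    · exact h h1
  · simp only [SeqHits, hn, Nat.succ_pos, true_and, zero_add]
    refine and_congr_right fun _ => ?_
    by_cases h1 : p 1 = e
    · have h0 : p 1 = p 0 := h.resolve_right fun h => h h1
      refine imp_congr (by rw [h0]) ⟨?_, ?_⟩
      · rintro ⟨m, hm, hme⟩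
        cases m with
        | zero => exact absurd (h0 ▸ h1) hme
        | succ m => exact ⟨m, by omega, hme⟩
      · rintro ⟨m, hm, hme⟩
        exact ⟨m + 1, by omega, hme⟩
    · simp only [h1, false_imp_iff, iff_true]
      exact fun _ => ⟨1, by omega, h1⟩

theorem mem_seqExcursion_iff_shift {p : ℕ → V} {e e' : V}
    (h : p 1 = p 0 ∨ p 1 ≠ e ∧ p 1 ≠ e') :
    p ∈ seqExcursion e e' ↔ (fun k => p (k + 1)) ∈ seqExcursion e e' := by
  have he := seqHits_succ_iff (p := p) (e := e) (h.imp_right And.left)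
  have he' := seqHits_succ_iff (p := p) (e := e') (h.imp_right And.right)
  constructor
  · rintro ⟨n, hn, hm⟩
    obtain ⟨n, rfl⟩ := Nat.exists_eq_succ_of_ne_zero hn.1.ne'
    exact ⟨n, (he n).1 hn, fun m hmn h => hm (m + 1) (by omega) ((he' m).2 h)⟩
  · rintro ⟨n, hn, hm⟩
    refine ⟨n + 1, (he n).2 hn, fun m hmn h => ?_⟩
    obtain ⟨m, rfl⟩ := Nat.exists_eq_succ_of_ne_zero h.1.ne'
    exact hm m (by omega) ((he' m).1 h)

theorem seqHits_one {p : ℕ → V} {e : V} : SeqHits p e 1 ↔ p 1 = e ∧ p 0 ≠ e := by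
  simp [SeqHits]

theorem mem_seqExcursion_of_one {p : ℕ → V} {e e' : V} (hne : e ≠ e') (h0 : p 0 ≠ e)
    (h1 : p 1 = e) : p ∈ seqExcursion e e' := by
  refine ⟨1, seqHits_one.2 ⟨h1, h0⟩, fun m hm h => ?_⟩
  obtain rfl : m = 1 := le_antisymm hm h.1
  exact hne (h1.symm.trans h.2.1)

theorem notMem_seqExcursion_of_one {p : ℕ → V} {e e' : V} (h0 : p 0 ≠ e')
    (h1 : p 1 = e') : p ∉ seqExcursion e e' :=
  fun ⟨_, hn, hm⟩ => hm 1 hn.1 (seqHits_one.2 ⟨h1, h0⟩)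

theorem notMem_seqExcursion_swap {p : ℕ → V} {e e' : V} (h : p ∈ seqExcursion e e') :
    p ∉ seqExcursion e' e := by
  obtain ⟨n, hn, hm⟩ := h
  rintro ⟨n', hn', hm'⟩
  rcases le_total n n' with h | h
  · exact hm' n h hn
  · exact hm n' h hn'

theorem measurableSet_seqExcursion [MeasurableSpace V] [DiscreteMeasurableSpace V] (e e' : V) :
    MeasurableSet (seqExcursion e e') := by
  have hhit : ∀ (e : V) (n : ℕ), Measurable fun p : ℕ → V => SeqHits p e n := by
    intro e n
    unfold SeqHits
    fun_prop
  exact measurableSet_setOfPred.2 <| Measurable.exists fun n => (hhit e n).and <|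
    Measurable.forall fun m => measurable_const.imp (hhit e' m).not

end Sequences

/-! ### The skeleton of a right-continuous path -/

section Skeleton

variable {V Ω : Type*}

/-- The path sampled at the multiples of `δ`. -/
def skeleton (X : ℝ≥0 → Ω → V) (δ : ℝ≥0) (ω : Ω) : ℕ → V := fun k => X (k * δ) ω

/-- The mesh `1 / (n + 1)`. -/
noncomputable def mesh (n : ℕ) : ℝ≥0 := 1 / ((n : ℝ≥0) + 1)

theorem mesh_pos (n : ℕ) : 0 < mesh n := by unfold mesh; positivity

theorem tendsto_mesh : Tendsto mesh atTop (𝓝 0) := tendsto_one_div_add_atTop_nhds_zero_nat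

theorem eventually_exists_nat_mul_mesh_mem {a b : ℝ≥0} (hab : a < b) :
    ∀ᶠ n in atTop, ∃ k : ℕ, a < k * mesh n ∧ k * mesh n < b := by
  filter_upwards [tendsto_mesh.eventually (gt_mem_nhds (tsub_pos_of_lt hab))] with n hn
  have hpos := mesh_pos n
  refine ⟨⌊a / mesh n⌋₊ + 1, ?_, ?_⟩
  · rw [← div_lt_iff₀ hpos]
    exact_mod_cast Nat.lt_floor_add_one _
  · have h : (⌊a / mesh n⌋₊ : ℝ≥0) * mesh n ≤ a := by
      rw [← le_div_iff₀ hpos]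
      exact Nat.floor_le zero_le
    calc ((⌊a / mesh n⌋₊ + 1 : ℕ) : ℝ≥0) * mesh n
        = (⌊a / mesh n⌋₊ : ℝ≥0) * mesh n + mesh n := by push_cast; ring
      _ < a + (b - a) := add_lt_add_of_le_of_lt h hn
      _ = b := add_tsub_cancel_of_le hab.le

theorem SeqHits.mem_hitTimes {X : ℝ≥0 → Ω → V} {δ : ℝ≥0} (hδ : 0 < δ) {ω : Ω} {e : V} {n : ℕ}
    (h : SeqHits (skeleton X δ ω) e n) : (n * δ : ℝ≥0) ∈ hitTimes X e ω := by
  obtain ⟨hn, hne, hleave⟩ := h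
  simp only [skeleton, Nat.cast_zero, zero_mul] at hleave hne
  have hn' : (0 : ℝ≥0) < n := by exact_mod_cast hn
  refine ⟨by positivity, hne, fun h0 => ?_⟩
  obtain ⟨m, hm, hme⟩ := hleave h0
  have hm0 : 0 < m := by
    rcases m.eq_zero_or_pos with rfl | hm0
    · simp [h0] at hme
    · exact hm0
  have hm0' : (0 : ℝ≥0) < m := by exact_mod_cast hm0
  exact ⟨m * δ, by positivity, mul_lt_mul_of_pos_right (by exact_mod_cast hm) hδ, hme⟩

theorem hitTime_le {X : ℝ≥0 → Ω → V} {e : V} {ω : Ω} {t : ℝ≥0} (ht : t ∈ hitTimes X e ω) :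
    hitTime X e ω ≤ t :=
  sInf_le ⟨t, ht, rfl⟩

theorem exists_mem_hitTimes_lt {X : ℝ≥0 → Ω → V} {e : V} {ω : Ω} {c : ℝ≥0∞}
    (h : hitTime X e ω < c) : ∃ t ∈ hitTimes X e ω, (t : ℝ≥0∞) < c := by
  obtain ⟨_, ⟨t, ht, rfl⟩, htc⟩ := sInf_lt_iff.1 h
  exact ⟨t, ht, htc⟩

theorem exists_forall_eq_of_rightContinuous {X : ℝ≥0 → Ω → V} {ω : Ω}
    (hω : ∀ t, ∀ᶠ u in 𝓝[>] t, X u ω = X t ω) (t : ℝ≥0) :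
    ∃ b > t, ∀ u, t ≤ u → u < b → X u ω = X t ω := by
  obtain ⟨b, hb, h⟩ := mem_nhdsGT_iff_exists_Ioo_subset.1 (hω t)
  refine ⟨b, hb, fun u htu hub => ?_⟩
  rcases htu.eq_or_lt with rfl | htu
  · rfl
  · exact h ⟨htu, hub⟩

/-- By right-continuity the hit of `e`, and the earlier absence from `e` if one is required, each
last for an interval, which a fine mesh meets. Skeleton hits of `e'` are genuine hits, so none comes
too early. -/
theorem eventually_skeleton_mem_seqExcursion {X : ℝ≥0 → Ω → V} {ω : Ω}
    (hω : ∀ t, ∀ᶠ u in 𝓝[>] t, X u ω = X t ω) {e e' : V}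
    (h : hitTime X e ω < hitTime X e' ω) :
    ∀ᶠ n in atTop, skeleton X (mesh n) ω ∈ seqExcursion e e' := by
  obtain ⟨t, ⟨ht0, hte, hleave⟩, htlt⟩ := exists_mem_hitTimes_lt h
  obtain ⟨b, hb, hconst⟩ := exists_forall_eq_of_rightContinuous hω t
  obtain ⟨c, htc, hc⟩ := ENNReal.lt_iff_exists_nnreal_btwn.1 htlt
  have htc' : t < c := by exact_mod_cast htc
  have hleave' : ∀ᶠ n in atTop, X 0 ω = e →
      ∃ k : ℕ, (k : ℝ≥0) * mesh n < t ∧ X (k * mesh n) ω ≠ e := by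
    by_cases h0 : X 0 ω = e
    · obtain ⟨u, -, hut, hue⟩ := hleave h0
      obtain ⟨d, hd, hconst'⟩ := exists_forall_eq_of_rightContinuous hω u
      filter_upwards [eventually_exists_nat_mul_mesh_mem (lt_min hut hd)] with n hn _
      obtain ⟨k, hk, hk'⟩ := hn
      refine ⟨k, hk'.trans_le (min_le_left _ _), ?_⟩
      rwa [hconst' _ hk.le (hk'.trans_le (min_le_right _ _))]
    · exact Eventually.of_forall fun _ h => absurd h h0
  filter_upwards [eventually_exists_nat_mul_mesh_mem (lt_min hb htc'), hleave'] with n hn hl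
  obtain ⟨k, hk, hk'⟩ := hn
  have hpos := mesh_pos n
  refine ⟨k, ⟨?_, ?_, ?_⟩, ?_⟩
  · rcases k.eq_zero_or_pos with rfl | hk0
    · simp at hk
    · exact hk0
  · exact (hconst _ hk.le (hk'.trans_le (min_le_left _ _))).trans hte
  · intro h0
    obtain ⟨m, hm, hme⟩ := hl (by simpa [skeleton] using h0)
    refine ⟨m, ?_, hme⟩
    have := lt_of_mul_lt_mul_right (hm.trans hk) hpos.le
    exact_mod_cast this
  · intro m hm hhit
    have h1 := hitTime_le (hhit.mem_hitTimes hpos)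
    have h2 : (m : ℝ≥0) * mesh n ≤ c :=
      (mul_le_mul_of_nonneg_right (by exact_mod_cast hm) hpos.le).trans
        (hk'.trans_le (min_le_right _ _)).le
    exact absurd (h1.trans (ENNReal.coe_le_coe.2 h2)) (not_le.2 hc)

/-- At a common finite value `T`, hits of both states occur arbitrarily soon from `T` on, where the
path is constant. -/
theorem eq_top_of_hitTime_eq {X : ℝ≥0 → Ω → V} {ω : Ω}
    (hω : ∀ t, ∀ᶠ u in 𝓝[>] t, X u ω = X t ω) {e e' : V} (hne : e ≠ e')
    (h : hitTime X e ω = hitTime X e' ω) : hitTime X e ω = ⊤ := by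
  by_contra htop
  lift hitTime X e ω to ℝ≥0 using htop with T hT
  obtain ⟨b, hb, hconst⟩ := exists_forall_eq_of_rightContinuous hω T
  have key : ∀ f, hitTime X f ω = T → X T ω = f := by
    intro f hf
    obtain ⟨t, ht, htb⟩ := exists_mem_hitTimes_lt (hf.trans_lt (ENNReal.coe_lt_coe.2 hb))
    have hTt : T ≤ t := by
      have := hitTime_le ht
      rw [hf] at this
      exact_mod_cast this
    exact (hconst t hTt (by exact_mod_cast htb)).symm.trans ht.2.1
  exact hne ((key e hT.symm).symm.trans (key e' h.symm))

theorem eventually_skeleton_mem_iff {X : ℝ≥0 → Ω → V} {ω : Ω}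
    (hω : ∀ t, ∀ᶠ u in 𝓝[>] t, X u ω = X t ω) {e e' : V} (hne : e ≠ e') :
    ∀ᶠ n in atTop, (skeleton X (mesh n) ω ∈ seqExcursion e e' ↔
      hitTime X e ω < hitTime X e' ω) := by
  rcases lt_trichotomy (hitTime X e ω) (hitTime X e' ω) with h | h | h
  · filter_upwards [eventually_skeleton_mem_seqExcursion hω h] with n hn
    exact iff_of_true hn h
  · refine Eventually.of_forall fun n => iff_of_false ?_ h.not_lt
    rintro ⟨k, hk, -⟩
    have := hitTime_le (hk.mem_hitTimes (mesh_pos n))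
    rw [eq_top_of_hitTime_eq hω hne h] at this
    exact ENNReal.coe_ne_top (top_le_iff.1 this)
  · filter_upwards [eventually_skeleton_mem_seqExcursion hω h] with n hn
    exact iff_of_false (notMem_seqExcursion_swap hn) h.not_gt

end Skeleton

/-! ### The Markov property of the skeleton -/

section Markov

/-- Two finite measures on sequences in a finite set agree if they agree on cylinders. -/
theorem measure_eq_of_real_cylinder {V : Type*} [Fintype V]
    [MeasurableSpace V] [DiscreteMeasurableSpace V] {μ ν : Measure (ℕ → V)}
    [IsFiniteMeasure μ] [IsFiniteMeasure ν]
    (h : ∀ (n : ℕ) (x : ℕ → V), μ.real {p | ∀ k ≤ n, p k = x k} =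
      ν.real {p | ∀ k ≤ n, p k = x k}) : μ = ν := by
  have hproj : ∀ ρ : Measure (ℕ → V), IsProjectiveLimit ρ fun I => ρ.map I.restrict :=
    fun ρ I => rfl
  have hfam : IsProjectiveMeasureFamily fun I : Finset ℕ => μ.map I.restrict :=
    fun I J hJI => by
      rw [Measure.map_map (by fun_prop) (by fun_prop)]
      rfl
  refine (hproj μ).unique ((isProjectiveLimit_nat_iff hfam ν).2 fun n => ?_)
  refine Measure.ext_of_singleton fun a => ?_
  -- The value given beyond `n` is only filler.
  have hpre : Preorder.frestrictLe (π := fun _ => V) n ⁻¹' {a} = {p | ∀ k ≤ n, p k =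
      if hk : k ≤ n then a ⟨k, Finset.mem_Iic.2 hk⟩ else a ⟨n, Finset.mem_Iic.2 le_rfl⟩} := by
    ext p
    simp only [Set.mem_preimage, Set.mem_singleton_iff, funext_iff, Subtype.forall,
      Finset.mem_Iic, Set.mem_ofPred_eq]
    refine forall₂_congr fun k hk => ?_
    rw [dif_pos hk]
    rfl
  have hreal := h n fun k =>
    if hk : k ≤ n then a ⟨k, Finset.mem_Iic.2 hk⟩ else a ⟨n, Finset.mem_Iic.2 le_rfl⟩
  rw [← hpre] at hreal
  change ν.map (Preorder.frestrictLe (π := fun _ => V) n) {a} =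
    μ.map (Preorder.frestrictLe (π := fun _ => V) n) {a}
  rw [Measure.map_apply (Preorder.measurable_frestrictLe n) (MeasurableSet.of_discrete),
    Measure.map_apply (Preorder.measurable_frestrictLe n) (MeasurableSet.of_discrete)]
  exact ((measureReal_eq_measureReal_iff).1 hreal).symm

variable {V Ω : Type*} [Fintype V] [DecidableEq V] [MeasurableSpace Ω]
  {Q : Matrix V V ℝ} {P : V → Measure Ω} {X : ℝ≥0 → Ω → V}

theorem IsMarkovJumpProcess.real_cylinder (hX : IsMarkovJumpProcess Q P X) (δ : ℝ≥0) (i : V)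
    (n : ℕ) (x : ℕ → V) :
    (P i).real {ω | ∀ k ≤ n, skeleton X δ ω k = x k} =
      (if x 0 = i then 1 else 0) *
        ∏ k ∈ Finset.range n, NormedSpace.exp ((δ : ℝ) • Q) (x k) (x (k + 1)) := by
  have := hX.isProbabilityMeasure i
  induction n with
  | zero =>
    have h : {ω | ∀ k ≤ 0, skeleton X δ ω k = x k} =ᵐ[P i] {_ω | x 0 = i} := by
      filter_upwards [hX.start i] with ω hω
      refine propext ?_
      change (∀ k ≤ 0, skeleton X δ ω k = x k) ↔ x 0 = i
      simp [skeleton, hω, eq_comm]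
    rw [measureReal_congr h]
    by_cases h0 : x 0 = i <;> simp [h0]
  | succ n ih =>
    have hmono : Monotone fun k : ℕ => (k : ℝ≥0) * δ := fun a b hab =>
      mul_le_mul_of_nonneg_right (by exact_mod_cast hab) zero_le
    have h := hX.markov i n _ x hmono
    have hδ : (((((n + 1 : ℕ) : ℝ≥0) * δ : ℝ≥0) : ℝ) - (((n : ℝ≥0) * δ : ℝ≥0) : ℝ)) = δ := by
      push_cast; ring
    rw [hδ] at h
    rw [Finset.prod_range_succ, ← mul_assoc, ← ih]
    exact h

theorem IsMarkovJumpProcess.real_cylinder_shift (hX : IsMarkovJumpProcess Q P X) (δ : ℝ≥0)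
    (i j : V) (n : ℕ) (x : ℕ → V) :
    (P i).real {ω | skeleton X δ ω 1 = j ∧ ∀ k ≤ n, skeleton X δ ω (k + 1) = x k} =
      NormedSpace.exp ((δ : ℝ) • Q) i j * (P j).real {ω | ∀ k ≤ n, skeleton X δ ω k = x k} := by
  by_cases hj : x 0 = j
  · have h : {ω | skeleton X δ ω 1 = j ∧ ∀ k ≤ n, skeleton X δ ω (k + 1) = x k} =ᵐ[P i]
        {ω | ∀ k ≤ n + 1, skeleton X δ ω k = if k = 0 then i else x (k - 1)} := by
      filter_upwards [hX.start i] with ω hω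
      refine propext ?_
      change (skeleton X δ ω 1 = j ∧ ∀ k ≤ n, skeleton X δ ω (k + 1) = x k) ↔
        ∀ k ≤ n + 1, skeleton X δ ω k = if k = 0 then i else x (k - 1)
      constructor
      · rintro ⟨-, h⟩ k hk
        cases k with
        | zero => simpa [skeleton] using hω
        | succ k => exact h k (by omega)
      · intro h
        exact ⟨(h 1 (by omega)).trans hj, fun k hk => h (k + 1) (by omega)⟩
    rw [measureReal_congr h, hX.real_cylinder, hX.real_cylinder, Finset.prod_range_succ']
    simp [hj, mul_comm]
  · have h : {ω | skeleton X δ ω 1 = j ∧ ∀ k ≤ n, skeleton X δ ω (k + 1) = x k} = ∅ := by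
      ext ω
      simp only [Set.mem_ofPred_eq, Set.mem_empty_iff_false, iff_false]
      rintro ⟨h1, h⟩
      exact hj ((h 0 (Nat.zero_le _)).symm.trans h1)
    rw [h, hX.real_cylinder]
    simp [hj]

/-- The entry is the probability of a two-point cylinder. -/
theorem IsMarkovJumpProcess.exp_nonneg (hX : IsMarkovJumpProcess Q P X) (δ : ℝ≥0) (i j : V) :
    0 ≤ NormedSpace.exp ((δ : ℝ) • Q) i j := by
  have h := hX.real_cylinder δ i 1 (fun k => if k = 0 then i else j)
  simp at h
  rw [← h]
  exact measureReal_nonneg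

variable [MeasurableSpace V]

theorem IsMarkovJumpProcess.measurable_skeleton (hX : IsMarkovJumpProcess Q P X) (δ : ℝ≥0) :
    Measurable (skeleton X δ) :=
  measurable_pi_lambda _ fun _ => measurable_to_countable' fun v => hX.measurableSet_eq _ v

variable [DiscreteMeasurableSpace V]

/-- The Markov property at the first step of the skeleton. -/
theorem IsMarkovJumpProcess.real_first_step (hX : IsMarkovJumpProcess Q P X) (δ : ℝ≥0) (i j : V)
    {B : Set (ℕ → V)} (hB : MeasurableSet B) :
    (P i).real {ω | skeleton X δ ω 1 = j ∧ (fun k => skeleton X δ ω (k + 1)) ∈ B} =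
      NormedSpace.exp ((δ : ℝ) • Q) i j * (P j).real {ω | skeleton X δ ω ∈ B} := by
  have := hX.isProbabilityMeasure
  have hm := hX.measurable_skeleton δ
  have hms : Measurable fun ω k => skeleton X δ ω (k + 1) :=
    measurable_pi_lambda _ fun k => (measurable_pi_apply (k + 1)).comp hm
  have hset : MeasurableSet {ω | skeleton X δ ω 1 = j} := hX.measurableSet_eq _ j
  have h0 := hX.exp_nonneg δ i j
  have hcyl : ∀ (n : ℕ) (x : ℕ → V), MeasurableSet {p : ℕ → V | ∀ k ≤ n, p k = x k} :=
    fun n x => measurableSet_setOfPred.2 (by fun_prop)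
  have hleft : ∀ {B : Set (ℕ → V)}, MeasurableSet B →
      (((P i).restrict {ω | skeleton X δ ω 1 = j}).map
        fun ω k => skeleton X δ ω (k + 1)).real B =
      (P i).real {ω | skeleton X δ ω 1 = j ∧ (fun k => skeleton X δ ω (k + 1)) ∈ B} := by
    intro B hB
    rw [map_measureReal_apply hms hB, measureReal_restrict_apply (hms hB), Set.inter_comm]
    rfl
  have hright : ∀ {B : Set (ℕ → V)}, MeasurableSet B →
      ((NormedSpace.exp ((δ : ℝ) • Q) i j).toNNReal • (P j).map (skeleton X δ)).real B =
      NormedSpace.exp ((δ : ℝ) • Q) i j * (P j).real {ω | skeleton X δ ω ∈ B} := by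
    intro B hB
    rw [measureReal_nnreal_smul_apply, map_measureReal_apply hm hB, Real.coe_toNNReal _ h0]
    rfl
  rw [← hleft hB, ← hright hB]
  congr 1
  refine measure_eq_of_real_cylinder fun n x => ?_
  rw [hleft (hcyl n x), hright (hcyl n x)]
  exact hX.real_cylinder_shift δ i j n x

/-- First-step equation for the skeleton. -/
theorem IsMarkovJumpProcess.real_seqExcursion_eq (hX : IsMarkovJumpProcess Q P X) (δ : ℝ≥0)
    {e e' : V} (hne : e ≠ e') (i : V) :
    (P i).real {ω | skeleton X δ ω ∈ seqExcursion e e'} =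
      ∑ j, if j = i ∨ j ≠ e ∧ j ≠ e' then
        NormedSpace.exp ((δ : ℝ) • Q) i j * (P j).real {ω | skeleton X δ ω ∈ seqExcursion e e'}
      else if j = e then NormedSpace.exp ((δ : ℝ) • Q) i e else 0 := by
  have := hX.isProbabilityMeasure
  have hA := measurableSet_seqExcursion e e'
  have hA' : MeasurableSet {ω | skeleton X δ ω ∈ seqExcursion e e'} := hX.measurable_skeleton δ hA
  have hsplit : (P i).real {ω | skeleton X δ ω ∈ seqExcursion e e'} =
      ∑ j, (P i).real {ω | skeleton X δ ω 1 = j ∧ skeleton X δ ω ∈ seqExcursion e e'} := by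
    rw [← measureReal_biUnion_finset]
    · congr 1
      ext ω
      simp
    · intro j _ k _ hjk
      exact Set.disjoint_left.2 fun ω h h' => hjk (h.1.symm.trans h'.1)
    · exact fun j _ => (hX.measurableSet_eq _ j).inter hA'
  rw [hsplit]
  have h0 : ∀ᵐ ω ∂(P i), skeleton X δ ω 0 = i := by
    filter_upwards [hX.start i] with ω hω
    simpa [skeleton] using hω
  refine Finset.sum_congr rfl fun j _ => ?_
  split_ifs with hj hje
  · rw [← hX.real_first_step δ i j hA]
    refine measureReal_congr ?_
    filter_upwards [h0] with ω hω
    refine propext (and_congr_right fun h1 => mem_seqExcursion_iff_shift ?_)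
    rwa [h1, hω]
  · subst hje
    have hij : i ≠ j := fun h => hj (Or.inl h.symm)
    -- A first step into `e` from elsewhere decides the excursion, so only the one-step law matters.
    have h := hX.real_first_step δ i j MeasurableSet.univ
    simp only [Set.mem_univ, and_true, Set.ofPred_true, probReal_univ, mul_one] at h
    rw [← h]
    refine measureReal_congr ?_
    filter_upwards [h0] with ω hω
    exact propext (and_iff_left_of_imp fun h1 =>
      mem_seqExcursion_of_one hne (by rwa [hω]) h1)
  · have hje' : j = e' := by
      by_contra h
      exact hj (Or.inr ⟨hje, h⟩)
    subst hje'
    have hij : i ≠ j := fun h => hj (Or.inl h.symm)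
    rw [measureReal_eq_zero_iff, measure_eq_zero_iff_ae_notMem]
    filter_upwards [h0] with ω hω h
    exact notMem_seqExcursion_of_one (by rwa [hω]) h.1 h.2

/-- The skeleton solves the linear system of its difference quotient. -/
theorem IsMarkovJumpProcess.zeroedRate_mulVec_skeleton (hX : IsMarkovJumpProcess Q P X)
    (δ : ℝ≥0) {e e' : V} (hne : e ≠ e') :
    zeroedRate ((δ : ℝ)⁻¹ • (NormedSpace.exp ((δ : ℝ) • Q) - 1)) e e' *ᵥ
        (fun i => (P i).real {ω | skeleton X δ ω ∈ seqExcursion e e'}) =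
      excursionRhs ((δ : ℝ)⁻¹ • (NormedSpace.exp ((δ : ℝ) • Q) - 1)) e := by
  ext i
  have h := hX.real_seqExcursion_eq δ hne i
  set g : V → ℝ := fun i => (P i).real {ω | skeleton X δ ω ∈ seqExcursion e e'} with hg
  set E := NormedSpace.exp ((δ : ℝ) • Q) with hE
  change g i = ∑ j, if j = i ∨ j ≠ e ∧ j ≠ e' then E i j * g j
    else if j = e then E i e else 0 at h
  rw [← Finset.add_sum_erase _ _ (Finset.mem_univ i), if_pos (Or.inl rfl)] at h
  have hterm : ∀ j ∈ Finset.univ.erase i,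
      (if j = i ∨ j ≠ e ∧ j ≠ e' then E i j * g j else if j = e then E i e else 0) =
      (if j = e ∨ j = e' then 0 else E i j * g j) + if j = e then E i j else 0 := by
    intro j hj
    have hji := Finset.ne_of_mem_erase hj
    by_cases h1 : j = e
    · subst h1; simp [hji]
    · by_cases h2 : j = e'
      · subst h2; simp [h1, hji]
      · simp [h1, h2, hji]
  rw [Finset.sum_congr rfl hterm, Finset.sum_add_distrib, Finset.sum_ite_eq'] at h
  have hterm' : ∀ j ∈ Finset.univ.erase i,
      (if j = e ∨ j = e' then 0 else ((δ : ℝ)⁻¹ • (E - 1)) i j * g j) =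
      (δ : ℝ)⁻¹ * if j = e ∨ j = e' then 0 else E i j * g j := by
    intro j hj
    have hij := (Finset.ne_of_mem_erase hj).symm
    split_ifs
    · simp
    · simp [Matrix.one_apply_ne hij, mul_assoc]
  rw [zeroedRate_mulVec_apply, Finset.sum_congr rfl hterm', ← Finset.mul_sum]
  have hfac : ((δ : ℝ)⁻¹ • (E - 1)) i i * g i = (δ : ℝ)⁻¹ * (E i i * g i - g i) := by
    simp; ring
  rw [hfac, ← mul_add]
  by_cases hie : i = e
  · subst hie
    simp only [Finset.mem_erase, ne_eq, not_true_eq_false, false_and, if_false, add_zero] at h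
    rw [excursionRhs, if_pos rfl]
    exact mul_eq_zero_of_right _ (by linarith)
  · simp only [Finset.mem_erase, Finset.mem_univ, and_true, ne_eq, Ne.symm hie,
      not_false_eq_true, if_true] at h
    simp only [excursionRhs, hie, if_false, Matrix.smul_apply, Matrix.sub_apply,
      Matrix.one_apply_ne hie, smul_eq_mul, sub_zero, ← mul_neg]
    congr 1
    linarith

end Markov

/-! ### Passage to the limit -/

section Limit

variable {V Ω : Type*} [Fintype V] [DecidableEq V] [MeasurableSpace Ω]
  {Q : Matrix V V ℝ} {P : V → Measure Ω} {X : ℝ≥0 → Ω → V}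

open scoped Matrix.Norms.Operator in
theorem tendsto_exp_mesh (Q : Matrix V V ℝ) (i j : V) :
    Tendsto (fun n => ((mesh n : ℝ)⁻¹ • (NormedSpace.exp ((mesh n : ℝ) • Q) - 1)) i j) atTop
      (𝓝 (Q i j)) := by
  have h := (hasDerivAt_exp_smul_const (𝕂 := ℝ) Q (0 : ℝ)).tendsto_slope_zero
  have hmesh : Tendsto (fun n => (mesh n : ℝ)) atTop (𝓝[≠] 0) := by
    refine tendsto_nhdsWithin_iff.2 ⟨?_, Eventually.of_forall fun n => ?_⟩
    · simpa using NNReal.tendsto_coe.2 tendsto_mesh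
    · exact (NNReal.coe_pos.2 (mesh_pos n)).ne'
  have h' := h.comp hmesh
  simp only [zero_smul, NormedSpace.exp_zero, one_mul, zero_add] at h'
  exact (((continuous_apply j).comp (continuous_apply i)).tendsto Q).comp h'

theorem IsMarkovJumpProcess.tendsto_real_seqExcursion (hX : IsMarkovJumpProcess Q P X)
    {e e' : V} (hne : e ≠ e') (i : V) :
    Tendsto (fun n => (P i).real {ω | skeleton X (mesh n) ω ∈ seqExcursion e e'}) atTop
      (𝓝 (excursionProb P X e e' i)) := by
  let _ : MeasurableSpace V := ⊤
  have := hX.isProbabilityMeasure i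
  have hAs : ∀ n, MeasurableSet {ω | skeleton X (mesh n) ω ∈ seqExcursion e e'} := fun n =>
    hX.measurable_skeleton (mesh n) (measurableSet_seqExcursion e e')
  have hlim : ∀ᵐ ω ∂(P i), ∀ᶠ n in atTop, (skeleton X (mesh n) ω ∈ seqExcursion e e' ↔
      hitTime X e ω < hitTime X e' ω) := by
    filter_upwards [hX.right_continuous i] with ω hω
    exact eventually_skeleton_mem_iff hω hne
  -- A measurable version of the excursion event, equal to it almost surely.
  set A : Set Ω := {ω | ∃ m, ∀ n ≥ m, skeleton X (mesh n) ω ∈ seqExcursion e e'} with hA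
  have hmem : ∀ᵐ ω ∂(P i), (ω ∈ A ↔ hitTime X e ω < hitTime X e' ω) := by
    filter_upwards [hlim] with ω hω
    rw [hA, Set.mem_ofPred_eq, ← eventually_atTop, eventually_congr hω, eventually_const]
  have hAm : MeasurableSet A := measurableSet_setOfPred.2 <| Measurable.exists fun m =>
    Measurable.forall fun n => measurable_const.imp (measurableSet_setOfPred.1 (hAs n))
  have hprob : excursionProb P X e e' i = (P i).real A := by
    refine measureReal_congr ?_
    filter_upwards [hmem] with ω hω
    exact propext hω.symm
  rw [hprob]
  refine (ENNReal.tendsto_toReal (measure_ne_top _ _)).comp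
    (tendsto_measure_of_ae_tendsto_indicator_of_isFiniteMeasure atTop hAm hAs ?_)
  filter_upwards [hlim, hmem] with ω h1 h2
  filter_upwards [h1] with n hn
  exact hn.trans h2.symm

theorem IsMarkovJumpProcess.zeroedRate_mulVec_excursionProb (hX : IsMarkovJumpProcess Q P X)
    {e e' : V} (hne : e ≠ e') :
    zeroedRate Q e e' *ᵥ excursionProb P X e e' = excursionRhs Q e := by
  let _ : MeasurableSpace V := ⊤
  ext i
  have heq := fun n => congrFun (hX.zeroedRate_mulVec_skeleton (mesh n) hne) i
  simp only [zeroedRate_mulVec_apply] at heq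
  rw [zeroedRate_mulVec_apply]
  have hE := tendsto_exp_mesh Q i
  have hp := hX.tendsto_real_seqExcursion hne
  refine tendsto_nhds_unique (((hE i).mul (hp i)).add (tendsto_finsetSum _ fun j _ => ?_))
    (Tendsto.congr (fun n => (heq n).symm) ?_)
  · split_ifs
    · exact tendsto_const_nhds
    · exact (hE j).mul (hp j)
  · unfold excursionRhs
    split_ifs
    · exact tendsto_const_nhds
    · exact (hE e).neg

end Limit

/-- The chain has finite state space `V`, in which `one ≠ two` are the states `1` and `2`. -/
theorem proposition3 {V Ω : Type*} [Fintype V] [DecidableEq V] [MeasurableSpace Ω]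
    (Q : Matrix V V ℝ) (hQ : IsRateMatrix Q) (hirr : IsIrreducibleRate Q)
    (P : V → Measure Ω) (X : ℝ≥0 → Ω → V) (hX : IsMarkovJumpProcess Q P X)
    (one two : V) (hne : one ≠ two) :
    (∀ u : V → ℝ, zeroedRate Q one two *ᵥ u = excursionRhs Q one ↔
        u = excursionProb P X one two) ∧
      (∀ u : V → ℝ, zeroedRate Q one two *ᵥ u = excursionRhs Q two ↔
        u = excursionProb P X two one) ∧
      (∀ i : V, excursionProb P X one two i + excursionProb P X two one i = 1) := by

  have hinj : ∀ u v : V → ℝ, zeroedRate Q one two *ᵥ u = zeroedRate Q one two *ᵥ v → u = v :=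
    fun u v h => sub_eq_zero.1 (eq_zero_of_zeroedRate_mulVec_eq_zero hQ hirr hne
      (by rw [Matrix.mulVec_sub, h, sub_self]))
  have h1 := hX.zeroedRate_mulVec_excursionProb hne
  have h2 := hX.zeroedRate_mulVec_excursionProb hne.symm
  rw [zeroedRate_comm] at h2
  refine ⟨fun u => ⟨fun h => hinj _ _ (h.trans h1.symm), fun h => h ▸ h1⟩,
    fun u => ⟨fun h => hinj _ _ (h.trans h2.symm), fun h => h ▸ h2⟩, fun i => ?_⟩
  refine congrFun (hinj (excursionProb P X one two + excursionProb P X two one) 1 ?_) i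
  rw [Matrix.mulVec_add, h1, h2, zeroedRate_mulVec_one hQ hne]
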